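/- Let $X$ be a real Banach space which is the topological direct sum $X = X_1 \oplus X_2$ of two closed, infinite-dimensional subspaces $X_1, X_2$, and let $p \in \{1,2,3,\dots\} \cup \{\infty\}$. A bump function on $X$ is a function $f : X \to \mathbb{R}$ that is not constantly zero and has bounded support $\overline{\{x \in X : f(x) \neq 0\}}$; $C^p$ is meant in the sense of Fréchet. Regard $X_1^*$ and $X_2^*$ as subspaces of $X^* = X_1^* \oplus X_2^*$, i.e. identify $\psi \in X_1^*$ with the functional $x_1 + x_2 \mapsto \psi(x_1)$ on $X$ ($x_1 \in X_1$, $x_2 \in X_2$), and likewise for $X_2^*$. Then the following are equivalent: (1) there is a $C^p$ bump function on $X$; (2) there is a $C^p$ bump function $f$ on $X$ such that $$\{\lambda f'(x) : x \in X,\ \lambda \in \mathbb{R}\} \cap (X_1^* \cup X_2^*) = \{0\} \quad\text{and}\quad \{f'(x) : x \in X,\ f(x) \neq 0\} \cap (X_1^* \cup X_2^*) = \emptyset .$$ The same equivalence holds when "$C^p$ bump function" is replaced by "$C^p$ bump function that is Lipschitz on $X$" in both (1) and (2). -/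

import Mathlib

/-- A bump function on `X`: a real function which is not constantly zero and whose support
(the closure of the set where it does not vanish) is bounded. -/
def IsBump {X : Type*} [NormedAddCommGroup X] (f : X → ℝ) : Prop :=
  (∃ x, f x ≠ 0) ∧ Bornology.IsBounded (tsupport f)

/-- A `C^p` smooth bump function, in the sense of Fréchet differentiability. -/
def IsSmoothBump {X : Type*} [NormedAddCommGroup X] [NormedSpace ℝ X] (p : ℕ∞) (f : X → ℝ) :
    Prop :=
  IsBump f ∧ ContDiff ℝ p f

/-- A `C^p` smooth bump function which is (globally) Lipschitz. -/
def IsSmoothLipschitzBump {X : Type*} [NormedAddCommGroup X] [NormedSpace ℝ X] (p : ℕ∞)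
    (f : X → ℝ) : Prop :=
  IsSmoothBump p f ∧ ∃ K : NNReal, LipschitzWith K f

/-- For `X = X₁ ⊕ X₂`, the copy of `X₁^*` inside `X^* = X₁^* ⊕ X₂^*`: the functionals
`x₁ + x₂ ↦ ψ x₁` with `ψ ∈ X₁^*`. -/
def dualSummand {X : Type*} [NormedAddCommGroup X] [NormedSpace ℝ X] (X₁ X₂ : Submodule ℝ X) :
    Set (X →L[ℝ] ℝ) :=
  {ξ | ∃ ψ : X₁ →L[ℝ] ℝ, ∀ (x₁ : X₁) (x₂ : X₂), ξ ((x₁ : X) + (x₂ : X)) = ψ x₁}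

/-- The set `{t f'(x) : x ∈ X, t ∈ ℝ}` of all multiples of derivatives of `f`. -/
def derivCone {X : Type*} [NormedAddCommGroup X] [NormedSpace ℝ X] (f : X → ℝ) :
    Set (X →L[ℝ] ℝ) :=
  {ξ | ∃ (x : X) (t : ℝ), ξ = t • fderiv ℝ f x}

/-- The set `{f'(x) : f(x) ≠ 0}`. -/
def derivOffZero {X : Type*} [NormedAddCommGroup X] [NormedSpace ℝ X] (f : X → ℝ) :
    Set (X →L[ℝ] ℝ) :=
  {ξ | ∃ x : X, f x ≠ 0 ∧ ξ = fderiv ℝ f x}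

open Set Filter Topology Metric

/-! ### Bounded separated paths in infinite dimensions -/

section Path

variable {Z : Type*} [NormedAddCommGroup Z] [NormedSpace ℝ Z]

/-! Only the direction from an arbitrary bump needs work. The core is the failure of Rolle's theorem
in infinite dimensions (`IsSmoothBump.exists_fderiv_ne_zero`): a smooth bump can be rebuilt so that
its derivative is nonzero wherever it is.

Split off a plane, so that the space is `Z × ℂ` with `Z` infinite-dimensional. Riesz's lemma gives a
bounded smooth path `q` in `Z` with `q s` and `q (s + k)` uniformly apart for integers `k > 0`, `s ≥
0`. A thin tube around the graph of `q` can then be wound around an annulus in `ℂ`, one turn per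
unit of time, without meeting itself. It is infinitely long yet bounded, so the function can start
flat at time 1 and increase (in absolute value) forever along the tube: it needs no critical point
where it is nonzero. Locally the wound function involves a single sheet of the tube
(`HasLocallySingleTranslate`), hence inherits smoothness and Lipschitz bounds.

Given such functions `f₁`, `f₂` on the two summands, take `f = (f₁ ∘ P₁ · f₂ ∘ P₂)²` with `P₁`, `P₂`
the projections. Where `f ≠ 0`, the restriction of `f'` to each summand is a nonzero multiple of the
corresponding `fᵢ'`, so `f'` lies in neither dual summand. Where `f = 0`, the square forces `f' =
0`. -/

theorem exists_seq_one_le_norm_sub_span (hZ : ¬ FiniteDimensional ℝ Z) :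
    ∃ e : ℕ → Z, (∀ n, ‖e n‖ ≤ 2) ∧
      ∀ n, ∀ y ∈ Submodule.span ℝ (e '' Iio n), 1 ≤ ‖e n - y‖ := by
  classical
  have key : ∀ s : Finset Z, ∃ x : Z, ‖x‖ ≤ 2 ∧
      ∀ y ∈ Submodule.span ℝ (s : Set Z), 1 ≤ ‖x - y‖ := by
    intro s
    have hfin : FiniteDimensional ℝ (Submodule.span ℝ (s : Set Z)) :=
      FiniteDimensional.span_finset ℝ s
    have hc : IsClosed (Submodule.span ℝ (s : Set Z) : Set Z) :=
      Submodule.closed_of_finiteDimensional _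
    have hne : ∃ x, x ∉ Submodule.span ℝ (s : Set Z) := by
      by_contra! h
      have htop : Submodule.span ℝ (s : Set Z) = ⊤ := by
        rw [Submodule.eq_top_iff']; exact h
      exact hZ (Module.finite_def.2 ⟨s, htop⟩)
    -- Any `c` strictly between 1 and the norm bound 2 would do here.
    exact riesz_lemma_of_norm_lt (c := (3 / 2 : ℝ)) (by norm_num) (by norm_num) hc hne
  choose g hg using key
  let s : ℕ → Finset Z := fun n => Nat.rec ∅ (fun _ t => insert (g t) t) n
  have hs : ∀ n, s (n + 1) = insert (g (s n)) (s n) := fun n => rfl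
  have hmem : ∀ n, ∀ j < n, g (s j) ∈ s n := by
    intro n
    induction n with
    | zero => intro j hj; omega
    | succ n ih =>
      intro j hj
      rw [hs]
      rcases Nat.lt_succ_iff_lt_or_eq.1 hj with h | rfl
      · exact Finset.mem_insert_of_mem (ih j h)
      · exact Finset.mem_insert_self _ _
  refine ⟨fun n => g (s n), fun n => (hg _).1, fun n y hy => (hg _).2 y ?_⟩
  refine Submodule.span_mono ?_ hy
  rintro _ ⟨j, hj, rfl⟩
  exact hmem n j hj

/-- A smooth monotone step, equal to `0` for `t ≤ 1/4` and to `1` for `t ≥ 3/4`. -/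
noncomputable def smoothStep (t : ℝ) : ℝ := Real.smoothTransition (2 * t - 1 / 2)

theorem contDiff_smoothStep {n : ℕ∞} : ContDiff ℝ n smoothStep :=
  Real.smoothTransition.contDiff.comp (by fun_prop)

theorem smoothStep_of_le {t : ℝ} (ht : t ≤ 1 / 4) : smoothStep t = 0 :=
  Real.smoothTransition.zero_of_nonpos (by linarith)

theorem smoothStep_of_ge {t : ℝ} (ht : 3 / 4 ≤ t) : smoothStep t = 1 :=
  Real.smoothTransition.one_of_one_le (by linarith)

theorem smoothStep_nonneg (t : ℝ) : 0 ≤ smoothStep t := Real.smoothTransition.nonneg _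

theorem smoothStep_le_one (t : ℝ) : smoothStep t ≤ 1 := Real.smoothTransition.le_one _

/-- The smooth path which runs along the segments `[e n, e (n + 1)]`, reaching `e n` at time
`n`, and which is constant on the negative half-line. -/
noncomputable def segmentPath (e : ℕ → Z) (s : ℝ) : Z :=
  e ⌊s⌋.toNat + smoothStep (s - ⌊s⌋) • (e (⌊s⌋ + 1).toNat - e ⌊s⌋.toNat)

/-- Because the step is constant near both ends, the formula of one segment stays valid for a margin
of 1/4 beyond it. Every time thus has a neighbourhood covered by one smooth formula, integers
included. -/
theorem segmentPath_eq_of_mem (e : ℕ → Z) (m : ℤ) {s : ℝ}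
    (hs : s ∈ Ioo (m - 1 / 4 : ℝ) (m + 5 / 4)) :
    segmentPath e s = e m.toNat + smoothStep (s - m) • (e (m + 1).toNat - e m.toNat) := by
  obtain ⟨h1, h2⟩ := hs
  unfold segmentPath
  rcases lt_or_ge s m with h | h
  · have hf : ⌊s⌋ = m - 1 := by
      rw [Int.floor_eq_iff]; push_cast; constructor <;> linarith
    rw [hf, smoothStep_of_ge (by push_cast; linarith), smoothStep_of_le (by linarith)]
    simp
  rcases lt_or_ge s (m + 1) with h' | h'
  · have hf : ⌊s⌋ = m := by
      rw [Int.floor_eq_iff]; constructor <;> linarith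
    rw [hf]
  · have hf : ⌊s⌋ = m + 1 := by
      rw [Int.floor_eq_iff]; push_cast; constructor <;> linarith
    rw [hf, smoothStep_of_ge (t := s - m) (by linarith),
      smoothStep_of_le (by push_cast; linarith)]
    simp

theorem segmentPath_eventuallyEq (e : ℕ → Z) (s₀ : ℝ) :
    segmentPath e =ᶠ[𝓝 s₀] fun s => e ⌊s₀⌋.toNat +
      smoothStep (s - ⌊s₀⌋) • (e (⌊s₀⌋ + 1).toNat - e ⌊s₀⌋.toNat) := by
  have h : Ioo (⌊s₀⌋ - 1 / 4 : ℝ) (⌊s₀⌋ + 5 / 4) ∈ 𝓝 s₀ :=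
    Ioo_mem_nhds (by linarith [Int.floor_le s₀]) (by linarith [Int.lt_floor_add_one s₀])
  filter_upwards [h] with s hs using segmentPath_eq_of_mem e _ hs

theorem contDiff_segmentPath (e : ℕ → Z) {n : ℕ∞} : ContDiff ℝ n (segmentPath e) := by
  rw [contDiff_iff_contDiffAt]
  intro s₀
  refine ContDiffAt.congr_of_eventuallyEq ?_ (segmentPath_eventuallyEq e s₀)
  have : ContDiff ℝ n (fun s : ℝ => smoothStep (s - ⌊s₀⌋)) :=
    contDiff_smoothStep.comp (by fun_prop)
  exact (contDiff_const.add (this.smul contDiff_const)).contDiffAt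

theorem exists_lipschitzWith_segmentPath {e : ℕ → Z} {R : ℝ} (he : ∀ n, ‖e n‖ ≤ R) :
    ∃ C, LipschitzWith C (segmentPath e) := by
  obtain ⟨B, hB⟩ := (isCompact_Icc (a := (0 : ℝ)) (b := 1)).exists_bound_of_continuousOn
    ((contDiff_smoothStep (n := 1)).continuous_deriv le_rfl).continuousOn
  have hd := (contDiff_segmentPath e (n := 1)).differentiable (by simp)
  have hR : 0 ≤ R := (norm_nonneg _).trans (he 0)
  have hB0 : 0 ≤ B := (norm_nonneg _).trans (hB 0 (by simp))
  refine ⟨(B * (R + R)).toNNReal, lipschitzWith_of_nnnorm_deriv_le hd fun s₀ => ?_⟩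
  rw [← NNReal.coe_le_coe, coe_nnnorm, Real.coe_toNNReal _ (by positivity), (segmentPath_eventuallyEq e s₀).deriv_eq]
  have h1 : HasDerivAt (fun s : ℝ => smoothStep (s - ⌊s₀⌋)) (deriv smoothStep (s₀ - ⌊s₀⌋)) s₀ :=
    (((contDiff_smoothStep (n := 1)).differentiable (by simp) _).hasDerivAt).comp_sub_const _ _
  rw [((h1.smul_const (e (⌊s₀⌋ + 1).toNat - e ⌊s₀⌋.toNat)).const_add _).deriv, norm_smul]
  refine mul_le_mul (hB _ ⟨?_, ?_⟩) ((norm_sub_le _ _).trans (add_le_add (he _) (he _)))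
    (norm_nonneg _) hB0
  · linarith [Int.floor_le s₀]
  · linarith [Int.lt_floor_add_one s₀]

theorem norm_segmentPath_le {e : ℕ → Z} {R : ℝ} (he : ∀ n, ‖e n‖ ≤ R) (s : ℝ) :
    ‖segmentPath e s‖ ≤ R := by
  have h : segmentPath e s = (1 - smoothStep (s - ⌊s⌋)) • e ⌊s⌋.toNat +
      smoothStep (s - ⌊s⌋) • e (⌊s⌋ + 1).toNat := by
    unfold segmentPath; module
  rw [h]
  exact mem_closedBall_zero_iff.1 <| (convex_closedBall (0 : Z) R)
    (mem_closedBall_zero_iff.2 (he _)) (mem_closedBall_zero_iff.2 (he _))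
    (sub_nonneg.2 (smoothStep_le_one _)) (smoothStep_nonneg _) (by ring)

/-- Times differing by an integer share the same interpolation parameter `t`. If `t ≥ 1/8`, the
newest vector `e (m + l + 1)` enters the difference with coefficient `t` and everything else lies in
the span of earlier vectors. If `t < 1/8`, the difference is close to `(1 - t) • (e (m + l) - e m)`,
with an error of at most `4 * t`, so its norm is at least `1 - 5 * t`. -/
theorem norm_segmentPath_sub_add_intCast_ge {e : ℕ → Z} (he : ∀ n, ‖e n‖ ≤ 2)
    (hsep : ∀ n, ∀ y ∈ Submodule.span ℝ (e '' Iio n), 1 ≤ ‖e n - y‖)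
    {s : ℝ} (hs : 0 ≤ s) {k : ℤ} (hk : 0 < k) :
    1 / 8 ≤ ‖segmentPath e s - segmentPath e (s + k)‖ := by
  obtain ⟨m, hm⟩ := Int.eq_ofNat_of_zero_le (Int.floor_nonneg.2 hs)
  obtain ⟨l, rfl⟩ := Int.eq_ofNat_of_zero_le hk.le
  have hl : 0 < l := by omega
  have hfl : ⌊s + ((l : ℤ) : ℝ)⌋ = ((m + l : ℕ) : ℤ) := by
    rw [Int.floor_add_intCast, hm]; push_cast; rfl
  have h1 : segmentPath e s = e m + smoothStep (s - m) • (e (m + 1) - e m) := by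
    unfold segmentPath
    rw [hm, show ((m : ℤ) + 1).toNat = m + 1 by omega]
    simp
  have h2 : segmentPath e (s + ((l : ℤ) : ℝ)) =
      e (m + l) + smoothStep (s - m) • (e (m + l + 1) - e (m + l)) := by
    unfold segmentPath
    rw [hfl, show (((m + l : ℕ) : ℤ) + 1).toNat = m + l + 1 by omega, Int.toNat_natCast]
    congr 3
    push_cast
    ring
  rw [h1, h2, norm_sub_rev]
  set t := smoothStep (s - m)
  have ht0 : 0 ≤ t := smoothStep_nonneg _
  have ht1 : t ≤ 1 := smoothStep_le_one _
  have hmem : ∀ {i j : ℕ}, i < j → e i ∈ Submodule.span ℝ (e '' Iio j) := fun h =>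
    Submodule.subset_span ⟨_, h, rfl⟩
  rcases le_or_gt (1 / 8) t with h | h
  · have hpos : 0 < t := by linarith
    set y : Z := t⁻¹ • ((e m + t • (e (m + 1) - e m)) - (1 - t) • e (m + l))
    have hy : y ∈ Submodule.span ℝ (e '' Iio (m + l + 1)) := by
      refine Submodule.smul_mem _ _ (Submodule.sub_mem _ (Submodule.add_mem _ (hmem (by omega))
        (Submodule.smul_mem _ _ (Submodule.sub_mem _ (hmem (by omega)) (hmem (by omega)))))
        (Submodule.smul_mem _ _ (hmem (by omega))))
    have heq : e (m + l) + t • (e (m + l + 1) - e (m + l)) - (e m + t • (e (m + 1) - e m)) =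
        t • (e (m + l + 1) - y) := by
      have hty : t • y = (e m + t • (e (m + 1) - e m)) - (1 - t) • e (m + l) :=
        smul_inv_smul₀ hpos.ne' _
      rw [smul_sub t _ y, hty]
      module
    rw [heq, norm_smul, Real.norm_of_nonneg ht0]
    nlinarith [hsep _ y hy]
  · have heq : (1 - t) • (e (m + l) - e m) =
        (e (m + l) + t • (e (m + l + 1) - e (m + l)) - (e m + t • (e (m + 1) - e m))) -
        t • (e (m + l + 1) - e (m + 1)) := by module
    have h3 := hsep (m + l) (e m) (hmem (by omega))
    have h4 : ‖e (m + l + 1) - e (m + 1)‖ ≤ 4 :=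
      (norm_sub_le _ _).trans (by linarith [he (m + l + 1), he (m + 1)])
    have h5 := congrArg norm heq
    rw [norm_smul, Real.norm_of_nonneg (by linarith)] at h5
    have h6 := norm_sub_le (e (m + l) + t • (e (m + l + 1) - e (m + l)) -
      (e m + t • (e (m + 1) - e m))) (t • (e (m + l + 1) - e (m + 1)))
    rw [norm_smul, Real.norm_of_nonneg ht0] at h6
    nlinarith [norm_nonneg (e (m + l + 1) - e (m + 1))]

/-- In an infinite-dimensional space there is a bounded smooth Lipschitz path whose points at
times differing by a nonzero integer are uniformly separated. -/
theorem exists_smooth_separated_path (hZ : ¬ FiniteDimensional ℝ Z) :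
    ∃ q : ℝ → Z, (∀ n : ℕ∞, ContDiff ℝ n q) ∧ (∃ C, LipschitzWith C q) ∧ (∀ s, ‖q s‖ ≤ 2) ∧
      ∀ s, 0 ≤ s → ∀ k : ℤ, 0 < k → 1 / 8 ≤ ‖q s - q (s + k)‖ := by
  obtain ⟨e, he, hsep⟩ := exists_seq_one_le_norm_sub_span hZ
  exact ⟨segmentPath e, fun n => contDiff_segmentPath e, exists_lipschitzWith_segmentPath he,
    norm_segmentPath_le he, fun s hs k hk => norm_segmentPath_sub_add_intCast_ge he hsep hs hk⟩

end Path

/-! ### Smooth local branches of the argument -/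

section Turn

/-- The argument of a complex number, measured in full turns. -/
noncomputable def turn (w : ℂ) : ℝ := w.arg / (2 * Real.pi)

/-- The branch of `turn`, up to integers, which is smooth near `w₀`. -/
noncomputable def localTurn (w₀ w : ℂ) : ℝ := turn (w / w₀) + turn w₀

theorem exists_turn_eq_of_angle_eq {w : ℂ} {a : ℝ}
    (h : (w.arg : Real.Angle) = ((2 * Real.pi * a : ℝ) : Real.Angle)) :
    ∃ k : ℤ, turn w = a + k := by
  obtain ⟨k, hk⟩ := Real.Angle.angle_eq_iff_two_pi_dvd_sub.1 h
  refine ⟨k, ?_⟩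
  have := Real.pi_pos
  unfold turn
  field_simp
  linarith

theorem two_pi_mul_turn (w : ℂ) : 2 * Real.pi * turn w = w.arg := by
  have := Real.pi_pos
  unfold turn
  field_simp

theorem exists_turn_eq_localTurn_add {w₀ w : ℂ} (h₀ : w₀ ≠ 0) (hw : w ≠ 0) :
    ∃ k : ℤ, turn w = localTurn w₀ w + k := by
  apply exists_turn_eq_of_angle_eq
  unfold localTurn
  rw [mul_add, two_pi_mul_turn, two_pi_mul_turn, Real.Angle.coe_add,
    Complex.arg_div_coe_angle hw h₀]
  abel

theorem exists_turn_mul_exp_eq {w : ℂ} (hw : w ≠ 0) (t : ℝ) :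
    ∃ k : ℤ, turn (w * Complex.exp ((2 * Real.pi * t : ℝ) * Complex.I)) = turn w + t + k := by
  apply exists_turn_eq_of_angle_eq
  rw [Complex.arg_mul_coe_angle hw (Complex.exp_ne_zero _), mul_add, two_pi_mul_turn,
    Real.Angle.coe_add, Complex.exp_mul_I]
  congr 1
  have := Complex.arg_cos_add_sin_mul_I_coe_angle ((2 * Real.pi * t : ℝ) : Real.Angle)
  simpa using this

theorem localTurn_self {w₀ : ℂ} (h₀ : w₀ ≠ 0) : localTurn w₀ w₀ = turn w₀ := by
  simp [localTurn, div_self h₀, turn]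

theorem localTurn_eq (w₀ w : ℂ) :
    localTurn w₀ w = (2 * Real.pi)⁻¹ * Complex.imCLM (Complex.log (w / w₀)) + turn w₀ := by
  simp only [localTurn, turn, Complex.imCLM_apply, Complex.log_im]
  ring

/-- Dividing by `w₀` moves the base point to 1, away from the branch cut of the logarithm. -/
theorem contDiffAt_localTurn {w₀ : ℂ} (h₀ : w₀ ≠ 0) {n : WithTop ℕ∞} :
    ContDiffAt ℝ n (localTurn w₀) w₀ := by
  have h1 : ContDiffAt ℂ n (fun w => Complex.log (w / w₀)) w₀ := by
    refine ContDiffAt.comp w₀ (Complex.contDiffAt_log ?_) (contDiffAt_id.div_const _)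
    simp [div_self h₀]
  have h2 : ContDiffAt ℝ n
      (fun w => (2 * Real.pi)⁻¹ * Complex.imCLM (Complex.log (w / w₀)) + turn w₀) w₀ :=
    (contDiffAt_const.mul (Complex.imCLM.contDiff.contDiffAt.comp w₀ (h1.restrict_scalars ℝ))).add
      contDiffAt_const
  exact h2.congr_of_eventuallyEq (Eventually.of_forall (localTurn_eq w₀))

theorem norm_fderiv_localTurn_le {w₀ : ℂ} (h₀ : 1 ≤ ‖w₀‖) :
    ‖fderiv ℝ (localTurn w₀) w₀‖ ≤ 1 := by
  have hne : w₀ ≠ 0 := by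
    rintro rfl
    norm_num at h₀
  have h1 : HasDerivAt (fun w => Complex.log (w / w₀)) w₀⁻¹ w₀ := by
    have := ((hasDerivAt_id w₀).div_const w₀).clog (by simp [div_self hne])
    simpa [div_self hne] using this
  have h2 := h1.hasFDerivAt.restrictScalars ℝ
  have h3 := ((Complex.imCLM.hasFDerivAt.comp w₀ h2).const_mul (2 * Real.pi)⁻¹).add_const (turn w₀)
  have h4 : HasFDerivAt (localTurn w₀) _ w₀ :=
    h3.congr_of_eventuallyEq (Eventually.of_forall (localTurn_eq w₀))
  rw [h4.fderiv, norm_smul]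
  have h5 : ‖(2 * Real.pi)⁻¹‖ ≤ 1 := by
    rw [norm_inv, Real.norm_of_nonneg (by positivity)]
    exact inv_le_one_of_one_le₀ (by linarith [Real.pi_gt_three])
  refine mul_le_one₀ h5 (norm_nonneg _) ((ContinuousLinearMap.opNorm_comp_le _ _).trans ?_)
  refine mul_le_one₀ Complex.imCLM_norm.le (norm_nonneg _) ?_
  refine ContinuousLinearMap.opNorm_le_bound _ zero_le_one fun v => ?_
  have : ‖w₀‖⁻¹ ≤ 1 := inv_le_one_of_one_le₀ h₀
  simpa [norm_mul] using mul_le_mul_of_nonneg_left this (norm_nonneg v)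

end Turn

/-! ### Winding a function around an annulus -/

section Wind

variable {Z : Type*}

/-- The `1`-periodization of `g : Z × ℝ → ℝ` in the second variable. -/
noncomputable def periodize (g : Z × ℝ → ℝ) (p : Z × ℝ) : ℝ := ∑' k : ℤ, g (p.1, p.2 + k)

theorem periodize_add_intCast (g : Z × ℝ → ℝ) (z : Z) (s : ℝ) (j : ℤ) :
    periodize g (z, s + j) = periodize g (z, s) := by
  unfold periodize
  rw [← (Equiv.addLeft j).tsum_eq (fun k : ℤ => g (z, s + k))]
  refine tsum_congr fun k => ?_
  simp [add_assoc]

variable [NormedAddCommGroup Z]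

/-- A function on `Z × ℝ` such that, locally, at most one of its integer translates in the real
variable is nonzero. -/
def HasLocallySingleTranslate (g : Z × ℝ → ℝ) : Prop :=
  ∀ p₀ : Z × ℝ, ∃ k₀ : ℤ, ∀ᶠ p in 𝓝 p₀, ∀ k : ℤ, k ≠ k₀ → g (p.1, p.2 + k) = 0

theorem HasLocallySingleTranslate.exists_periodize_eventuallyEq {g : Z × ℝ → ℝ}
    (hg : HasLocallySingleTranslate g) (p₀ : Z × ℝ) :
    ∃ k₀ : ℤ, periodize g =ᶠ[𝓝 p₀] fun p => g (p.1, p.2 + k₀) := by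
  obtain ⟨k₀, hk⟩ := hg p₀
  refine ⟨k₀, ?_⟩
  filter_upwards [hk] with p hp using tsum_eq_single k₀ hp

/-- A smooth function on `ℂ` supported in an annulus. -/
noncomputable def annulusBump (w : ℂ) : ℝ :=
  (⟨1 / 2, 1, by norm_num, by norm_num⟩ : ContDiffBump (2 : ℝ)) (‖w‖ ^ 2)

theorem contDiff_annulusBump {n : ℕ∞} : ContDiff ℝ n annulusBump :=
  ContDiff.comp (ContDiffBump.contDiff _) (contDiff_norm_sq ℝ)

theorem mem_of_annulusBump_ne_zero {w : ℂ} (hw : annulusBump w ≠ 0) :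
    1 < ‖w‖ ^ 2 ∧ ‖w‖ ^ 2 < 3 := by
  have h : ‖w‖ ^ 2 ∈ ball (2 : ℝ) 1 := by
    by_contra h
    exact hw (ContDiffBump.zero_of_le_dist _ (by simpa using h))
  rw [Real.ball_eq_Ioo] at h
  exact ⟨by linarith [h.1], by linarith [h.2]⟩

theorem one_lt_norm_of_annulusBump_ne_zero {w : ℂ} (hw : annulusBump w ≠ 0) : 1 < ‖w‖ := by
  nlinarith [mem_of_annulusBump_ne_zero hw, norm_nonneg w]

theorem norm_lt_two_of_annulusBump_ne_zero {w : ℂ} (hw : annulusBump w ≠ 0) : ‖w‖ < 2 := by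
  nlinarith [mem_of_annulusBump_ne_zero hw, norm_nonneg w]

theorem abs_annulusBump_le_one (w : ℂ) : |annulusBump w| ≤ 1 := by
  rw [annulusBump, abs_of_nonneg (ContDiffBump.nonneg _)]
  exact ContDiffBump.le_one _

theorem annulusBump_ne_zero {w : ℂ} (hw : ‖w‖ ^ 2 = 2) : annulusBump w ≠ 0 := by
  rw [annulusBump, hw]
  exact (ContDiffBump.pos_of_mem_ball _ (by simp)).ne'

theorem annulusBump_congr {w w' : ℂ} (h : ‖w‖ = ‖w'‖) : annulusBump w = annulusBump w' := by
  rw [annulusBump, annulusBump, h]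

theorem exists_lipschitzWith_annulusBump : ∃ C, LipschitzWith C annulusBump := by
  refine ContDiff.lipschitzWith_of_hasCompactSupport (𝕂 := ℝ) (n := ((1 : ℕ∞) : WithTop ℕ∞)) ?_
    contDiff_annulusBump (by simp)
  refine HasCompactSupport.of_support_subset_isCompact (isCompact_closedBall (0 : ℂ) 2) ?_
  intro w hw
  simpa using (norm_lt_two_of_annulusBump_ne_zero hw).le

/-- The function on `Z × ℂ` obtained by winding `g : Z × ℝ → ℝ` around an annulus in `ℂ`. -/
noncomputable def wind (g : Z × ℝ → ℝ) (x : Z × ℂ) : ℝ :=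
  annulusBump x.2 * periodize g (x.1, turn x.2)

/-- Periodicity absorbs the integer jumps of `turn`, so it may be replaced by its smooth branch near
the base point; then only one translate survives in the sum. -/
theorem HasLocallySingleTranslate.exists_wind_eventuallyEq {g : Z × ℝ → ℝ}
    (hg : HasLocallySingleTranslate g) (x₀ : Z × ℂ) (h₀ : x₀.2 ≠ 0) :
    ∃ k₀ : ℤ, wind g =ᶠ[𝓝 x₀] fun x =>
      annulusBump x.2 * g (x.1, localTurn x₀.2 x.2 + k₀) := by
  obtain ⟨k₀, hk⟩ := hg.exists_periodize_eventuallyEq (x₀.1, turn x₀.2)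
  refine ⟨k₀, ?_⟩
  have hc : ContinuousAt (fun x : Z × ℂ => (x.1, localTurn x₀.2 x.2)) x₀ :=
    continuousAt_fst.prodMk <| ContinuousAt.comp (x := x₀) (f := Prod.snd)
      (contDiffAt_localTurn h₀ (n := 0)).continuousAt continuousAt_snd
  have ht : Tendsto (fun x : Z × ℂ => (x.1, localTurn x₀.2 x.2)) (𝓝 x₀)
      (𝓝 (x₀.1, turn x₀.2)) := by
    simpa only [ContinuousAt, localTurn_self h₀] using hc
  have hne : ∀ᶠ x : Z × ℂ in 𝓝 x₀, x.2 ≠ 0 := continuousAt_snd.eventually_ne h₀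
  filter_upwards [ht.eventually hk, hne] with x hx hx0
  obtain ⟨k, hk⟩ := exists_turn_eq_localTurn_add h₀ hx0
  rw [wind, hk, periodize_add_intCast, hx]

theorem wind_eventuallyEq_zero (g : Z × ℝ → ℝ) {x₀ : Z × ℂ} (h : ‖x₀.2‖ < 1) :
    wind g =ᶠ[𝓝 x₀] 0 := by
  have : ∀ᶠ x : Z × ℂ in 𝓝 x₀, ‖x.2‖ < 1 :=
    (continuous_snd.norm.continuousAt (x := x₀)).eventually (gt_mem_nhds h)
  filter_upwards [this] with x hx
  have h0 : annulusBump x.2 = 0 := by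
    by_contra h0
    exact (one_lt_norm_of_annulusBump_ne_zero h0).not_gt hx
  simp [wind, h0]

variable [NormedSpace ℝ Z]

theorem contDiff_wind {g : Z × ℝ → ℝ} (hg : HasLocallySingleTranslate g) {n : ℕ∞}
    (hs : ContDiff ℝ n g) : ContDiff ℝ n (wind g) := by
  rw [contDiff_iff_contDiffAt]
  intro x₀
  rcases lt_or_ge ‖x₀.2‖ 1 with h | h
  · exact contDiffAt_const.congr_of_eventuallyEq (wind_eventuallyEq_zero g h)
  have h₀ : x₀.2 ≠ 0 := norm_pos_iff.1 (by linarith)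
  obtain ⟨k₀, hk⟩ := hg.exists_wind_eventuallyEq x₀ h₀
  refine ContDiffAt.congr_of_eventuallyEq ?_ hk
  refine (contDiff_annulusBump.comp contDiff_snd).contDiffAt.mul ?_
  refine hs.contDiffAt.comp x₀ (contDiffAt_fst.prodMk (ContDiffAt.add ?_ contDiffAt_const))
  exact ContDiffAt.comp x₀ (contDiffAt_localTurn h₀) contDiffAt_snd

/-- The local formula bounds the derivative uniformly: inside the unit disc the function vanishes,
and elsewhere the branch of the argument has derivative of norm at most 1. Boundedness of `g`
controls the term where the annulus factor is differentiated. -/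
theorem exists_lipschitzWith_wind {g : Z × ℝ → ℝ} (hg : HasLocallySingleTranslate g)
    (hs : ContDiff ℝ 1 g) {K : NNReal} (hK : LipschitzWith K g) {B : ℝ} (hB : ∀ p, |g p| ≤ B) :
    ∃ C, LipschitzWith C (wind g) := by
  obtain ⟨A, hA⟩ := exists_lipschitzWith_annulusBump
  have hB0 : 0 ≤ B := (abs_nonneg _).trans (hB 0)
  have hd : Differentiable ℝ (wind g) :=
    (contDiff_wind hg (n := 1) (by exact_mod_cast hs)).differentiable (by simp)
  refine ⟨K + B.toNNReal * A, lipschitzWith_of_nnnorm_fderiv_le (𝕜 := ℝ) hd fun x₀ => ?_⟩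
  rw [← NNReal.coe_le_coe, coe_nnnorm, NNReal.coe_add, NNReal.coe_mul, Real.coe_toNNReal _ hB0]
  rcases lt_or_ge ‖x₀.2‖ 1 with h | h
  · rw [(wind_eventuallyEq_zero g h).fderiv_eq]
    have : fderiv ℝ (0 : Z × ℂ → ℝ) x₀ = 0 := by simp
    rw [this, norm_zero]
    positivity
  have h₀ : x₀.2 ≠ 0 := norm_pos_iff.1 (by linarith)
  obtain ⟨k₀, hk⟩ := hg.exists_wind_eventuallyEq x₀ h₀
  have d1 : HasFDerivAt (fun x : Z × ℂ => annulusBump x.2)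
      ((fderiv ℝ annulusBump x₀.2).comp (ContinuousLinearMap.snd ℝ Z ℂ)) x₀ :=
    (((contDiff_annulusBump (n := 1)).differentiable (by simp) _).hasFDerivAt).comp x₀
      hasFDerivAt_snd
  have d2 : HasFDerivAt (fun x : Z × ℂ => localTurn x₀.2 x.2)
      ((fderiv ℝ (localTurn x₀.2) x₀.2).comp (ContinuousLinearMap.snd ℝ Z ℂ)) x₀ :=
    (((contDiffAt_localTurn h₀ (n := 1)).differentiableAt (by simp)).hasFDerivAt).comp x₀
      hasFDerivAt_snd
  have d3 := ((hs.differentiable (by simp)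
    (x₀.1, localTurn x₀.2 x₀.2 + k₀)).hasFDerivAt).comp x₀
      ((hasFDerivAt_fst (𝕜 := ℝ) (E := Z) (F := ℂ) (p := x₀)).prodMk (d2.add_const (k₀ : ℝ)))
  have d4 : HasFDerivAt (wind g) _ x₀ := (d1.mul d3).congr_of_eventuallyEq hk
  rw [d4.fderiv]
  have n1 : ‖(fderiv ℝ annulusBump x₀.2).comp (ContinuousLinearMap.snd ℝ Z ℂ)‖ ≤ A := by
    refine (ContinuousLinearMap.opNorm_comp_le _ _).trans ?_
    simpa using mul_le_mul (norm_fderiv_le_of_lipschitz ℝ hA)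
      (ContinuousLinearMap.norm_snd_le ℝ Z ℂ) (norm_nonneg _) A.2
  have n2 : ‖(fderiv ℝ (localTurn x₀.2) x₀.2).comp (ContinuousLinearMap.snd ℝ Z ℂ)‖ ≤ 1 :=
    (ContinuousLinearMap.opNorm_comp_le _ _).trans
      (mul_le_one₀ (norm_fderiv_localTurn_le h) (norm_nonneg _)
        (ContinuousLinearMap.norm_snd_le ℝ Z ℂ))
  refine (norm_add_le _ _).trans (add_le_add ?_ ?_)
  · rw [norm_smul]
    refine (mul_le_of_le_one_left (norm_nonneg _) (abs_annulusBump_le_one _)).trans ?_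
    refine (ContinuousLinearMap.opNorm_comp_le _ _).trans ?_
    refine (mul_le_mul (norm_fderiv_le_of_lipschitz ℝ hK) ?_ (norm_nonneg _) K.2).trans
      (mul_one _).le
    refine ContinuousLinearMap.opNorm_le_bound _ zero_le_one fun v => ?_
    rw [ContinuousLinearMap.prod_apply, Prod.norm_def, one_mul]
    refine max_le (norm_fst_le v) ?_
    simpa using ContinuousLinearMap.le_of_opNorm_le _ n2 v
  · rw [norm_smul]
    exact mul_le_mul (hB _) n1 (norm_nonneg _) hB0

end Wind

/-! ### Estimates for the radial cut-off and for products -/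

theorem expNegInvGlue_le_one (x : ℝ) : expNegInvGlue x ≤ 1 := by
  unfold expNegInvGlue
  split_ifs with h
  · exact zero_le_one
  · exact Real.exp_le_one_iff.2 (by simpa using (not_le.1 h).le)

theorem hasDerivAt_expNegInvGlue (x : ℝ) :
    HasDerivAt expNegInvGlue (x⁻¹ ^ 2 * expNegInvGlue x) x := by
  simpa using expNegInvGlue.hasDerivAt_polynomial_eval_inv_mul 1 x

/-- With `y = 1 / x`, the derivative is `y² * exp (-y)`, and `y² / 2 ≤ exp y` for `y ≥ 0`. -/
theorem lipschitzWith_expNegInvGlue : LipschitzWith 2 expNegInvGlue := by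
  refine lipschitzWith_of_nnnorm_deriv_le
    (fun x => (hasDerivAt_expNegInvGlue x).differentiableAt) fun x => ?_
  rw [(hasDerivAt_expNegInvGlue x).deriv, ← NNReal.coe_le_coe, coe_nnnorm,
    Real.norm_of_nonneg (mul_nonneg (sq_nonneg _) (expNegInvGlue.nonneg _))]
  rcases le_or_gt x 0 with h | h
  · simp [expNegInvGlue.zero_of_nonpos h]
  · have hx : 0 < x⁻¹ := inv_pos.2 h
    have h1 := Real.quadratic_le_exp_of_nonneg hx.le
    rw [expNegInvGlue, if_neg h.not_ge, Real.exp_neg, ← div_eq_mul_inv,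
      div_le_iff₀ (Real.exp_pos _), NNReal.coe_ofNat]
    linarith

theorem LipschitzWith.mul_of_abs_le {E : Type*} [PseudoMetricSpace E] {u v : E → ℝ}
    {Ku Kv Bu Bv : NNReal} (hu : LipschitzWith Ku u) (hv : LipschitzWith Kv v)
    (hBu : ∀ x, |u x| ≤ Bu) (hBv : ∀ x, |v x| ≤ Bv) :
    LipschitzWith (Bu * Kv + Bv * Ku) fun x => u x * v x := by
  refine LipschitzWith.of_dist_le_mul fun x y => ?_
  have h1 := hu.dist_le_mul x y
  have h2 := hv.dist_le_mul x y
  rw [Real.dist_eq] at h1 h2 ⊢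
  have h3 : u x * v x - u y * v y = u x * (v x - v y) + v y * (u x - u y) := by ring
  rw [h3]
  refine (abs_add_le _ _).trans ?_
  rw [abs_mul, abs_mul]
  push_cast
  have h4 := mul_le_mul (hBu x) h2 (abs_nonneg _) Bu.coe_nonneg
  have h5 := mul_le_mul (hBv y) h1 (abs_nonneg _) Bv.coe_nonneg
  linarith

/-! ### The tube around the path -/

section Tube

variable {Z : Type*} [NormedAddCommGroup Z]

/-- A function on `Z × ℝ` supported in a tube around the graph of the path `q`, with
cross-section `b` and increasing along translates of the path after time `1`. -/
noncomputable def tube (q : ℝ → Z) (b : Z → ℝ) (p : Z × ℝ) : ℝ :=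
  expNegInvGlue (p.2 - 1) * b (p.1 - q p.2)

theorem one_lt_of_tube_ne_zero {q : ℝ → Z} {b : Z → ℝ} {p : Z × ℝ} (h : tube q b p ≠ 0) :
    1 < p.2 := by
  by_contra hp
  exact h (by simp [tube, expNegInvGlue.zero_of_nonpos (x := p.2 - 1) (by linarith)])

/-- Two different translates active near one point would bring `q (s + k)` and `q (s + k')` within
`3 * (1/40) + 2 * (1/80) = 1/10`, contradicting the separation 1/8: two tube radii, the variation of
`q` over the small time interval, and the radius of the ball in `Z` counted twice. -/
theorem hasLocallySingleTranslate_tube {q : ℝ → Z} {b : Z → ℝ} {C : NNReal}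
    (hq : LipschitzWith C q) (hsep : ∀ s, 0 ≤ s → ∀ k : ℤ, 0 < k → 1 / 8 ≤ ‖q s - q (s + k)‖)
    (hb : ∀ z, b z ≠ 0 → ‖z‖ ≤ 1 / 40) : HasLocallySingleTranslate (tube q b) := by
  rintro ⟨z₀, s₀⟩
  -- Chosen so that `q` moves by at most 1/40 on an interval of length `2 * η`; the added 1 covers
  -- `C = 0`.
  set η : ℝ := 1 / (80 * (C + 1))
  have hη : 0 < η := by positivity
  have hCη : C * (2 * η) ≤ 1 / 40 := by
    have : η * (80 * (C + 1)) = 1 := by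
      simp only [η]
      field_simp
    nlinarith
  have hη1 : η ≤ 1 / 80 := by
    refine one_div_le_one_div_of_le (by norm_num) ?_
    linarith [C.coe_nonneg]
  have hb' : ∀ z s (k : ℤ), tube q b (z, s + k) ≠ 0 → ‖z - q (s + k)‖ ≤ 1 / 40 :=
    fun z s k h => hb _ (right_ne_zero_of_mul h)
  have key : ∀ p ∈ ball z₀ (1 / 80) ×ˢ ball s₀ η, ∀ p' ∈ ball z₀ (1 / 80) ×ˢ ball s₀ η,
      ∀ k k' : ℤ, tube q b (p.1, p.2 + k) ≠ 0 → tube q b (p'.1, p'.2 + k') ≠ 0 → ¬ k < k' := by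
    rintro ⟨z, s⟩ ⟨hz, hs⟩ ⟨z', s'⟩ ⟨hz', hs'⟩ k k' h h' hlt
    rw [mem_ball_iff_norm] at hz hz'
    rw [mem_ball_iff_norm, Real.norm_eq_abs, abs_lt] at hs hs'
    dsimp only at hz hz' hs hs' h h'
    -- The cut-off before time 1 keeps the earlier time nonnegative, where the path is separated.
    have h1 : 1 < s + k := one_lt_of_tube_ne_zero h
    have h3 := hsep (s + k) (by linarith) (k' - k) (by omega)
    rw [show s + k + ((k' - k : ℤ) : ℝ) = s + k' by push_cast; ring] at h3
    have h4 := hb' _ _ _ h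
    have h5 := hb' _ _ _ h'
    have h6 : ‖q (s' + k') - q (s + k')‖ ≤ 1 / 40 := by
      rw [← dist_eq_norm]
      refine (hq.dist_le_mul _ _).trans (le_trans ?_ hCη)
      refine mul_le_mul_of_nonneg_left ?_ C.coe_nonneg
      rw [Real.dist_eq, abs_le]
      constructor <;> linarith
    have h7 : q (s + k) - q (s + k') = (z' - q (s' + k')) - (z - q (s + k)) +
        (q (s' + k') - q (s + k')) + (z - z₀) - (z' - z₀) := by abel
    have h8 : ‖q (s + k) - q (s + k')‖ ≤ 1 / 40 + 1 / 40 + 1 / 40 + ‖z - z₀‖ + ‖z' - z₀‖ := by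
      rw [h7]
      refine (norm_sub_le _ _).trans (add_le_add_left ((norm_add_le _ _).trans
        (add_le_add_left ((norm_add_le _ _).trans (add_le_add ((norm_sub_le _ _).trans
        (add_le_add h5 h4)) h6)) _)) _)
    linarith
  have hnhds : ball z₀ (1 / 80) ×ˢ ball s₀ η ∈ 𝓝 (z₀, s₀) :=
    prod_mem_nhds (ball_mem_nhds _ (by norm_num)) (ball_mem_nhds _ hη)
  by_cases hex : ∃ p ∈ ball z₀ (1 / 80) ×ˢ ball s₀ η, ∃ k : ℤ, tube q b (p.1, p.2 + k) ≠ 0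
  · obtain ⟨p, hp, k₀, hk₀⟩ := hex
    refine ⟨k₀, ?_⟩
    filter_upwards [hnhds] with p' hp' k hk
    by_contra h
    rcases lt_or_gt_of_ne hk with hlt | hlt
    · exact key p' hp' p hp _ _ h hk₀ hlt
    · exact key p hp p' hp' _ _ hk₀ h hlt
  · push Not at hex
    refine ⟨0, ?_⟩
    filter_upwards [hnhds] with p hp k _ using hex p hp k

theorem exists_lipschitzWith_tube {q : ℝ → Z} {b : Z → ℝ} {C K B : NNReal}
    (hq : LipschitzWith C q) (hb : LipschitzWith K b) (hB : ∀ z, |b z| ≤ B) :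
    ∃ K', LipschitzWith K' (tube q b) := by
  have h1 : LipschitzWith (2 * 1) fun p : Z × ℝ => expNegInvGlue (p.2 - 1) := by
    refine lipschitzWith_expNegInvGlue.comp ?_
    simpa using (LipschitzWith.prod_snd (α := Z) (β := ℝ)).sub (LipschitzWith.const (1 : ℝ))
  have h2 : LipschitzWith (K * (1 + C * 1)) fun p : Z × ℝ => b (p.1 - q p.2) :=
    hb.comp (LipschitzWith.prod_fst.sub (hq.comp LipschitzWith.prod_snd))
  refine ⟨_, h1.mul_of_abs_le (Bu := 1) h2 (fun p => ?_) fun p => hB _⟩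
  rw [abs_of_nonneg (expNegInvGlue.nonneg _)]
  exact expNegInvGlue_le_one _

theorem abs_tube_le {q : ℝ → Z} {b : Z → ℝ} {B : ℝ} (hB : ∀ z, |b z| ≤ B) (p : Z × ℝ) :
    |tube q b p| ≤ B := by
  rw [tube, abs_mul, abs_of_nonneg (expNegInvGlue.nonneg _)]
  exact (mul_le_of_le_one_left (abs_nonneg _) (expNegInvGlue_le_one _)).trans (hB _)

/-- The point sits at time 2, where the cut-off is positive, over `√2`, which has argument 0 and
lies in the middle of the annulus bump. The other translates vanish there, so nothing can cancel. -/
theorem exists_wind_tube_ne_zero {q : ℝ → Z} {b : Z → ℝ}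
    (hg : HasLocallySingleTranslate (tube q b)) (hb : ∃ z, b z ≠ 0) :
    ∃ x, wind (tube q b) x ≠ 0 := by
  obtain ⟨z, hz⟩ := hb
  have hturn : turn ((√2 : ℝ) : ℂ) = 0 := by
    simp [turn, Complex.arg_ofReal_of_nonneg (Real.sqrt_nonneg 2)]
  obtain ⟨k₀, hk₀⟩ := hg (z + q 2, 0)
  have ht : tube q b (z + q 2, 0 + ((2 : ℤ) : ℝ)) ≠ 0 := by
    simpa [tube] using And.intro (by norm_num : ¬ (2 : ℝ) ≤ 1) hz
  have hk : (2 : ℤ) = k₀ := by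
    by_contra h
    exact ht (hk₀.self_of_nhds 2 h)
  subst hk
  refine ⟨(z + q 2, ((√2 : ℝ) : ℂ)), mul_ne_zero (annulusBump_ne_zero ?_) ?_⟩
  · rw [Complex.norm_real, Real.norm_of_nonneg (Real.sqrt_nonneg 2), Real.sq_sqrt (by norm_num)]
  · dsimp only
    rw [hturn, periodize, tsum_eq_single 2 hk₀.self_of_nhds]
    exact ht

theorem norm_le_of_wind_tube_ne_zero {q : ℝ → Z} {b : Z → ℝ} {Q : ℝ} (hq : ∀ s, ‖q s‖ ≤ Q)
    (hb : ∀ z, b z ≠ 0 → ‖z‖ ≤ 1 / 40) {x : Z × ℂ} (hx : wind (tube q b) x ≠ 0) :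
    ‖x‖ ≤ max (Q + 1 / 40) 2 := by
  refine max_le_max ?_ (norm_lt_two_of_annulusBump_ne_zero (left_ne_zero_of_mul hx)).le
  have h1 : periodize (tube q b) (x.1, turn x.2) ≠ 0 := right_ne_zero_of_mul hx
  obtain ⟨k, hk⟩ : ∃ k : ℤ, tube q b (x.1, turn x.2 + k) ≠ 0 := by
    by_contra! h
    exact h1 (by simp only [periodize, h, tsum_zero])
  have h2 := hb _ (right_ne_zero_of_mul hk)
  have h3 := norm_add_le (q (turn x.2 + k)) (x.1 - q (turn x.2 + k))
  rw [add_sub_cancel] at h3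
  exact h3.trans (add_le_add (hq _) h2)

variable [NormedSpace ℝ Z]

theorem contDiff_tube {q : ℝ → Z} {b : Z → ℝ} {n : ℕ∞} (hq : ContDiff ℝ n q)
    (hb : ContDiff ℝ n b) : ContDiff ℝ n (tube q b) :=
  (expNegInvGlue.contDiff.comp (contDiff_snd.sub contDiff_const)).mul
    (hb.comp (contDiff_fst.sub (hq.comp contDiff_snd)))

/-- Moving along the tube keeps the annulus factor and the cross-section factor constant, while the
cut-off has positive derivative after time 1. The directional derivative is therefore nonzero. -/
theorem fderiv_wind_tube_ne_zero {q : ℝ → Z} {b : Z → ℝ} (hq : Differentiable ℝ q)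
    (hg : HasLocallySingleTranslate (tube q b)) {x₀ : Z × ℂ}
    (hd : DifferentiableAt ℝ (wind (tube q b)) x₀) (hx : wind (tube q b) x₀ ≠ 0) :
    fderiv ℝ (wind (tube q b)) x₀ ≠ 0 := by
  obtain ⟨z₀, w₀⟩ := x₀
  have hκ : annulusBump w₀ ≠ 0 := left_ne_zero_of_mul hx
  have hw : w₀ ≠ 0 := norm_pos_iff.1 (by linarith [one_lt_norm_of_annulusBump_ne_zero hκ])
  obtain ⟨k₀, hk₀⟩ := hg.exists_periodize_eventuallyEq (z₀, turn w₀)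
  set s₀ : ℝ := turn w₀ + k₀
  have hper : tube q b (z₀, s₀) ≠ 0 := by
    have h1 := hk₀.self_of_nhds
    have h2 : periodize (tube q b) (z₀, turn w₀) ≠ 0 := right_ne_zero_of_mul hx
    rwa [h1] at h2
  have hs₀ : 1 < s₀ := one_lt_of_tube_ne_zero hper
  have hb : b (z₀ - q s₀) ≠ 0 := right_ne_zero_of_mul hper
  -- The curve parallel to the tube: the `Z` part follows a translate of `q` while the complex part
  -- rotates at one turn per unit of time.
  let γ : ℝ → Z × ℂ := fun t => (z₀ + (q (s₀ + t) - q s₀),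
    w₀ * Complex.exp ((2 * Real.pi * t : ℝ) * Complex.I))
  have hγ0 : γ 0 = (z₀, w₀) := by simp [γ]
  have hγd : DifferentiableAt ℝ γ 0 := by
    have : Differentiable ℝ (fun t : ℝ => Complex.exp ((2 * Real.pi * t : ℝ) * Complex.I)) := by
      intro t
      have h : DifferentiableAt ℝ (fun t : ℝ => ((2 * Real.pi * t : ℝ) : ℂ) * Complex.I) t :=
        (Complex.ofRealCLM.differentiableAt.comp t
          (differentiableAt_id.const_mul (2 * Real.pi))).mul_const _
      exact h.cexp
    exact DifferentiableAt.prodMk (by fun_prop) (this.const_mul w₀ 0)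
  have hcurve : (fun t => wind (tube q b) (γ t)) =ᶠ[𝓝 0] fun t =>
      annulusBump w₀ * (expNegInvGlue (s₀ + t - 1) * b (z₀ - q s₀)) := by
    have hc : Tendsto (fun t : ℝ => (z₀ + (q (s₀ + t) - q s₀), turn w₀ + t)) (𝓝 0)
        (𝓝 (z₀, turn w₀)) := by
      have : Continuous (fun t : ℝ => (z₀ + (q (s₀ + t) - q s₀), turn w₀ + t)) := by
        have := hq.continuous
        fun_prop
      simpa using this.tendsto 0
    filter_upwards [hc.eventually hk₀] with t ht
    obtain ⟨k, hk⟩ := exists_turn_mul_exp_eq hw t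
    have hnorm : ‖w₀ * Complex.exp ((2 * Real.pi * t : ℝ) * Complex.I)‖ = ‖w₀‖ := by
      rw [norm_mul, Complex.norm_exp_ofReal_mul_I, mul_one]
    simp only [wind, γ]
    rw [annulusBump_congr hnorm, hk, periodize_add_intCast, ht]
    simp only [tube]
    rw [show turn w₀ + t + k₀ = s₀ + t by simp only [s₀]; ring]
    congr 3
    abel
  intro h0
  have d1 : HasDerivAt (fun t => wind (tube q b) (γ t)) 0 0 := by
    have h1 : HasFDerivAt (wind (tube q b)) (0 : Z × ℂ →L[ℝ] ℝ) (γ 0) := by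
      rw [hγ0, ← h0]
      exact hd.hasFDerivAt
    exact h1.comp_hasDerivAt 0 hγd.hasDerivAt
  have d2 : HasDerivAt (fun t : ℝ => expNegInvGlue (s₀ + t - 1))
      ((s₀ - 1)⁻¹ ^ 2 * expNegInvGlue (s₀ - 1)) 0 := by
    have h1 : HasDerivAt (fun t : ℝ => s₀ + t - 1) 1 0 :=
      ((hasDerivAt_id (0 : ℝ)).const_add s₀).sub_const 1
    have h2 : HasDerivAt expNegInvGlue ((s₀ - 1)⁻¹ ^ 2 * expNegInvGlue (s₀ - 1)) (s₀ + 0 - 1) := by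
      simpa using hasDerivAt_expNegInvGlue (s₀ - 1)
    have h3 := h2.comp (0 : ℝ) h1
    rwa [mul_one] at h3
  have d3 := ((d2.mul_const (b (z₀ - q s₀))).const_mul (annulusBump w₀)).congr_of_eventuallyEq
    hcurve
  have h3 := d1.unique d3
  have hpos : 0 < s₀ - 1 := by linarith
  have : annulusBump w₀ * ((s₀ - 1)⁻¹ ^ 2 * expNegInvGlue (s₀ - 1) * b (z₀ - q s₀)) ≠ 0 :=
    mul_ne_zero hκ (mul_ne_zero (mul_ne_zero (by positivity)
      (expNegInvGlue.pos_of_pos hpos).ne') hb)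
  exact this h3.symm

end Tube

/-! ### Bumps on Banach spaces and the failure of Rolle's theorem -/

section Bump

variable {X : Type*} [NormedAddCommGroup X]

theorem isBump_iff {f : X → ℝ} :
    IsBump f ↔ (∃ x, f x ≠ 0) ∧ ∃ R, ∀ x, f x ≠ 0 → ‖x‖ ≤ R := by
  refine and_congr_right fun _ => ⟨fun h => ?_, fun ⟨R, hR⟩ => ?_⟩
  · obtain ⟨R, hR⟩ := h.exists_norm_le
    exact ⟨R, fun x hx => hR x (subset_tsupport f hx)⟩
  · have hs : Function.support f ⊆ closedBall 0 R := fun x hx => by simpa using hR x hx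
    exact isBounded_closedBall.subset (closure_minimal hs isClosed_closedBall)

theorem IsBump.exists_abs_le {f : X → ℝ} (hf : IsBump f) {K : NNReal} (hK : LipschitzWith K f) :
    ∃ B : NNReal, ∀ x, |f x| ≤ B := by
  obtain ⟨-, R, hR⟩ := isBump_iff.1 hf
  refine ⟨(|f 0| + K * R).toNNReal, fun x => ?_⟩
  rw [Real.coe_toNNReal']
  rcases eq_or_ne (f x) 0 with h | h
  · rw [h, abs_zero]
    exact le_max_right _ _
  · refine le_max_of_le_left ?_
    have h1 := hK.dist_le_mul x 0
    rw [Real.dist_eq, dist_zero_right] at h1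
    have h2 := abs_sub_abs_le_abs_sub (f x) (f 0)
    have h3 := mul_le_mul_of_nonneg_left (hR x h) K.coe_nonneg
    linarith

variable [NormedSpace ℝ X]

/-- Restricting to a subspace may give zero, so the bump is first recentred at a point where it does
not vanish; a large dilation then makes the support as small as desired. -/
theorem IsSmoothBump.exists_comp {p : ℕ∞} {b : X → ℝ} (hb : IsSmoothBump p b)
    {E : Type*} [NormedAddCommGroup E] [NormedSpace ℝ E] (A : E →L[ℝ] X) {c : ℝ}
    (hA : ∀ e, ‖e‖ ≤ c * ‖A e‖) {r : ℝ} (hr : 0 < r) :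
    ∃ b' : E → ℝ, IsSmoothBump p b' ∧ (∀ e, b' e ≠ 0 → ‖e‖ ≤ r) ∧
      ((∃ K, LipschitzWith K b) → ∃ K, LipschitzWith K b') := by
  obtain ⟨hbump, hsmooth⟩ := hb
  obtain ⟨⟨x₀, hx₀⟩, R, hR⟩ := isBump_iff.1 hbump
  set S : ℝ := |c| * (R + ‖x₀‖)
  have hR0 : 0 ≤ R := (norm_nonneg _).trans (hR x₀ hx₀)
  have hS : 0 ≤ S := by positivity
  -- On the support `M * ‖e‖ ≤ S`, so this dilation forces `‖e‖ ≤ r`; the added 1 keeps `M`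
  -- positive.
  set M : ℝ := (S + 1) / r
  have hM : 0 < M := by positivity
  have hsupp : ∀ e, b (x₀ + (M • A) e) ≠ 0 → ‖e‖ ≤ r := by
    intro e he
    have h1 := hR _ he
    have h2 : M * ‖A e‖ ≤ R + ‖x₀‖ := by
      have h3 := norm_sub_le (x₀ + (M • A) e) x₀
      rw [add_sub_cancel_left, smul_apply, norm_smul,
        Real.norm_of_nonneg hM.le] at h3
      exact h3.trans (add_le_add_left h1 _)
    have h3 : M * ‖e‖ ≤ S := by
      calc M * ‖e‖ ≤ M * (|c| * ‖A e‖) := by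
            gcongr
            exact (hA e).trans (mul_le_mul_of_nonneg_right (le_abs_self c) (norm_nonneg _))
        _ = |c| * (M * ‖A e‖) := by ring
        _ ≤ S := mul_le_mul_of_nonneg_left h2 (abs_nonneg c)
    have h4 : M * r = S + 1 := div_mul_cancel₀ _ hr.ne'
    exact le_of_mul_le_mul_left (by linarith) hM
  refine ⟨fun e => b (x₀ + (M • A) e), ⟨isBump_iff.2 ⟨⟨0, by simpa using hx₀⟩, r, hsupp⟩, ?_⟩,
    hsupp, ?_⟩
  · exact hsmooth.comp (contDiff_const.add (M • A).contDiff)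
  · rintro ⟨K, hK⟩
    exact ⟨_, hK.comp ((LipschitzWith.const x₀).add (M • A).lipschitz)⟩

/-- A two-dimensional subspace is complemented and isomorphic to `ℂ`; its complement stays
infinite-dimensional. -/
theorem exists_continuousLinearEquiv_prod_complex (hX : ¬ FiniteDimensional ℝ X) :
    ∃ Z : Submodule ℝ X, ¬ FiniteDimensional ℝ Z ∧ Nonempty (X ≃L[ℝ] Z × ℂ) := by
  have hrank : ((2 : ℕ) : Cardinal) ≤ Module.rank ℝ X :=
    (Cardinal.natCast_le_aleph0).trans (not_lt.1 fun h => hX (Module.rank_lt_aleph0_iff.1 h))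
  obtain ⟨f, hf⟩ := Module.le_rank_iff_exists_linearMap.1 hrank
  have hfr : Module.finrank ℝ (LinearMap.range f) = Module.finrank ℝ ℂ := by
    rw [LinearMap.finrank_range_of_inj hf]
    simp
  obtain ⟨Z, e, -⟩ := (Submodule.ClosedComplemented.of_finiteDimensional
    (LinearMap.range f)).exists_submodule_equiv_prod
  refine ⟨Z, fun hZ => hX ?_, ⟨(e.trans (ContinuousLinearEquiv.prodComm ℝ _ _)).trans
    ((ContinuousLinearEquiv.refl ℝ Z).prodCongr (ContinuousLinearEquiv.ofFinrankEq hfr))⟩⟩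
  exact Module.Finite.equiv e.symm.toLinearEquiv

/-- The failure of Rolle's theorem: an infinite-dimensional space with a smooth bump function has
one whose derivative does not vanish wherever the function does not. -/
theorem IsSmoothBump.exists_fderiv_ne_zero {p : ℕ∞} (hp : 1 ≤ p) {b : X → ℝ}
    (hb : IsSmoothBump p b) (hX : ¬ FiniteDimensional ℝ X) :
    ∃ f : X → ℝ, IsSmoothBump p f ∧ (∀ x, f x ≠ 0 → fderiv ℝ f x ≠ 0) ∧
      ((∃ K, LipschitzWith K b) → ∃ K, LipschitzWith K f) := by
  obtain ⟨Z, hZ, ⟨T⟩⟩ := exists_continuousLinearEquiv_prod_complex hX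
  obtain ⟨q, hq, ⟨C, hC⟩, hqb, hsep⟩ := exists_smooth_separated_path hZ
  obtain ⟨b', ⟨hb'1, hb'2⟩, hb'3, hb'4⟩ := hb.exists_comp Z.subtypeL (c := 1) (by simp)
    (r := 1 / 40) (by norm_num)
  have hloc := hasLocallySingleTranslate_tube hC hsep hb'3
  have htube : ContDiff ℝ p (tube q b') := contDiff_tube (hq p) hb'2
  have hF : ContDiff ℝ p (wind (tube q b')) := contDiff_wind hloc htube
  have hp' : ((1 : ℕ∞) : WithTop ℕ∞) ≤ p := by exact_mod_cast hp
  have hp0 : (p : WithTop ℕ∞) ≠ 0 := by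
    intro h
    rw [h] at hp'
    simp at hp'
  refine ⟨wind (tube q b') ∘ T, ⟨isBump_iff.2 ⟨?_, ?_⟩, hF.comp T.contDiff⟩, ?_, ?_⟩
  · obtain ⟨x, hx⟩ := exists_wind_tube_ne_zero hloc hb'1.1
    exact ⟨T.symm x, by simpa using hx⟩
  · refine ⟨‖(T.symm : Z × ℂ →L[ℝ] X)‖ * max (2 + 1 / 40) 2, fun x hx => ?_⟩
    have h1 := norm_le_of_wind_tube_ne_zero hqb hb'3 hx
    have h2 := (T.symm : Z × ℂ →L[ℝ] X).le_opNorm_of_le h1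
    simpa using h2
  · intro x hx h0
    rw [T.comp_right_fderiv] at h0
    refine fderiv_wind_tube_ne_zero ((hq 1).differentiable (by simp)) hloc
      (hF.differentiable hp0 _) hx ?_
    refine ContinuousLinearMap.ext fun v => ?_
    simpa using DFunLike.congr_fun h0 (T.symm v)
  · intro hLip
    obtain ⟨K, hK⟩ := hb'4 hLip
    obtain ⟨B, hB⟩ := hb'1.exists_abs_le hK
    obtain ⟨K', hK'⟩ := exists_lipschitzWith_tube hC hK hB
    obtain ⟨L, hL⟩ := exists_lipschitzWith_wind hloc (htube.of_le hp') hK' (abs_tube_le hB)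
    exact ⟨_, hL.comp (T : X →L[ℝ] Z × ℂ).lipschitz⟩

theorem mem_dualSummand_apply_eq_zero {X₁ X₂ : Submodule ℝ X} {ξ : X →L[ℝ] ℝ}
    (h : ξ ∈ dualSummand X₁ X₂) (x : X₂) : ξ x = 0 := by
  obtain ⟨ψ, hψ⟩ := h
  simpa using hψ 0 x

theorem zero_mem_dualSummand (X₁ X₂ : Submodule ℝ X) : (0 : X →L[ℝ] ℝ) ∈ dualSummand X₁ X₂ :=
  ⟨0, by simp⟩

theorem IsSmoothBump.exists_derivative_avoids_dualSummands [CompleteSpace X]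
    {X₁ X₂ : Submodule ℝ X} (hX₁ : IsClosed (X₁ : Set X)) (hX₂ : IsClosed (X₂ : Set X))
    (hX : IsCompl X₁ X₂) (hdim₁ : ¬ FiniteDimensional ℝ X₁) (hdim₂ : ¬ FiniteDimensional ℝ X₂)
    {p : ℕ∞} (hp : 1 ≤ p) {b : X → ℝ} (hb : IsSmoothBump p b) :
    ∃ f : X → ℝ, IsSmoothBump p f ∧
      derivCone f ∩ (dualSummand X₁ X₂ ∪ dualSummand X₂ X₁) = {0} ∧
      derivOffZero f ∩ (dualSummand X₁ X₂ ∪ dualSummand X₂ X₁) = ∅ ∧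
      ((∃ K, LipschitzWith K b) → ∃ K, LipschitzWith K f) := by
  obtain ⟨b₁, hb₁, -, hb₁L⟩ := hb.exists_comp X₁.subtypeL (c := 1) (by simp) one_pos
  obtain ⟨b₂, hb₂, -, hb₂L⟩ := hb.exists_comp X₂.subtypeL (c := 1) (by simp) one_pos
  obtain ⟨f₁, ⟨hf₁, hs₁⟩, hd₁, hL₁⟩ := hb₁.exists_fderiv_ne_zero hp hdim₁
  obtain ⟨f₂, ⟨hf₂, hs₂⟩, hd₂, hL₂⟩ := hb₂.exists_fderiv_ne_zero hp hdim₂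
  have hp0 : (p : WithTop ℕ∞) ≠ 0 := by
    intro h
    have h1 : p = 0 := by exact_mod_cast h
    simp [h1] at hp
  have hcompl : Submodule.IsTopCompl X₁ X₂ := Submodule.IsCompl.isTopCompl_of_isClosed hX hX₁ hX₂
  set P₁ : X →L[ℝ] X₁ := X₁.projectionOntoL X₂ hcompl
  set P₂ : X →L[ℝ] X₂ := X₂.projectionOntoL X₁ hcompl.symm
  have hP₁₁ : ∀ x : X₁, P₁ x = x := Submodule.projectionOntoL_apply_left hcompl
  have hP₁₂ : ∀ x : X₂, P₁ x = 0 := Submodule.projectionOntoL_apply_right hcompl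
  have hP₂₂ : ∀ x : X₂, P₂ x = x := Submodule.projectionOntoL_apply_left hcompl.symm
  have hP₂₁ : ∀ x : X₁, P₂ x = 0 := Submodule.projectionOntoL_apply_right hcompl.symm
  have hsum : ∀ x : X, (P₁ x : X) + P₂ x = x := by
    intro x
    obtain ⟨y, hy, z, hz, rfl⟩ := Submodule.mem_sup.1
      (hX.sup_eq_top ▸ Submodule.mem_top : x ∈ X₁ ⊔ X₂)
    have h1 : P₁ (y + z) = ⟨y, hy⟩ := by
      rw [map_add, hP₁₁ ⟨y, hy⟩, hP₁₂ ⟨z, hz⟩, add_zero]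
    have h2 : P₂ (y + z) = ⟨z, hz⟩ := by
      rw [map_add, hP₂₁ ⟨y, hy⟩, hP₂₂ ⟨z, hz⟩, zero_add]
    rw [h1, h2]
  let u : X → ℝ := fun x => f₁ (P₁ x) * f₂ (P₂ x)
  have hu : ∀ x, HasFDerivAt u (f₁ (P₁ x) • (fderiv ℝ f₂ (P₂ x)).comp P₂ +
      f₂ (P₂ x) • (fderiv ℝ f₁ (P₁ x)).comp P₁) x := fun x =>
    ((hs₁.differentiable hp0 _).hasFDerivAt.comp x P₁.hasFDerivAt).mul
      ((hs₂.differentiable hp0 _).hasFDerivAt.comp x P₂.hasFDerivAt)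
  -- Squaring is needed: where only `f₁ ∘ P₁` vanishes, the derivative of `u` is a multiple of `f₁'
  -- ∘ P₁`, which lies in the first dual summand and need not be zero.
  let f : X → ℝ := fun x => u x * u x
  have hf : ∀ x v, fderiv ℝ f x v = 2 * u x * (f₁ (P₁ x) * fderiv ℝ f₂ (P₂ x) (P₂ v) +
      f₂ (P₂ x) * fderiv ℝ f₁ (P₁ x) (P₁ v)) := by
    intro x v
    have h : HasFDerivAt f _ x := (hu x).mul (hu x)
    rw [h.fderiv]
    simp
    ring
  have hzero : ∀ x, f x = 0 → fderiv ℝ f x = 0 := by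
    intro x hx
    have hx' : u x = 0 := mul_self_eq_zero.1 hx
    ext v
    rw [hf, hx']
    simp
  -- An element of one dual summand kills the other subspace, and on that subspace `f'` is a nonzero
  -- multiple of the nonzero derivative of `f₁` or `f₂`. The case `t = 1` gives the second
  -- condition.
  have hsmul : ∀ x, f x ≠ 0 → ∀ t : ℝ,
      t • fderiv ℝ f x ∈ dualSummand X₁ X₂ ∪ dualSummand X₂ X₁ → t = 0 := by
    intro x hx t ht
    have hux : u x ≠ 0 := left_ne_zero_of_mul hx
    have hx₁ : f₁ (P₁ x) ≠ 0 := left_ne_zero_of_mul hux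
    have hx₂ : f₂ (P₂ x) ≠ 0 := right_ne_zero_of_mul hux
    by_contra ht0
    rcases ht with ht | ht
    · refine hd₂ _ hx₂ ?_
      ext v
      have h := mem_dualSummand_apply_eq_zero ht v
      rw [smul_apply, hf, hP₂₂, hP₁₂, smul_eq_mul] at h
      simpa [ht0, hux, hx₁] using h
    · refine hd₁ _ hx₁ ?_
      ext v
      have h := mem_dualSummand_apply_eq_zero ht v
      rw [smul_apply, hf, hP₂₁, hP₁₁, smul_eq_mul] at h
      simpa [ht0, hux, hx₂] using h
  have hne : ∀ x, f x ≠ 0 → f₁ (P₁ x) ≠ 0 ∧ f₂ (P₂ x) ≠ 0 := fun x hx =>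
    mul_ne_zero_iff.1 (left_ne_zero_of_mul hx)
  obtain ⟨⟨x₁, hx₁⟩, R₁, hR₁⟩ := isBump_iff.1 hf₁
  obtain ⟨⟨x₂, hx₂⟩, R₂, hR₂⟩ := isBump_iff.1 hf₂
  have hus : ContDiff ℝ p u := (hs₁.comp P₁.contDiff).mul (hs₂.comp P₂.contDiff)
  refine ⟨f, ⟨isBump_iff.2 ⟨⟨x₁ + x₂, ?_⟩, R₁ + R₂, fun x hx => ?_⟩, hus.mul hus⟩, ?_, ?_, ?_⟩
  · have h : u (x₁ + x₂) ≠ 0 := by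
      simp only [u]
      rw [map_add, map_add, hP₁₁, hP₁₂, hP₂₁, hP₂₂, add_zero, zero_add]
      exact mul_ne_zero hx₁ hx₂
    exact mul_ne_zero h h
  · rw [← hsum x]
    exact (norm_add_le _ _).trans (add_le_add (hR₁ _ (hne x hx).1) (hR₂ _ (hne x hx).2))
  · refine Subset.antisymm ?_ ?_
    · rintro _ ⟨⟨x, t, rfl⟩, h⟩
      rw [mem_singleton_iff]
      by_cases hx : f x = 0
      · rw [hzero x hx, smul_zero]
      · rw [hsmul x hx t h, zero_smul]
    · rintro _ rfl
      exact ⟨⟨0, 0, (zero_smul _ _).symm⟩, Or.inl (zero_mem_dualSummand _ _)⟩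
  · rw [eq_empty_iff_forall_notMem]
    rintro _ ⟨⟨x, hx, rfl⟩, h⟩
    exact one_ne_zero (hsmul x hx 1 (by rwa [one_smul]))
  · intro hL
    obtain ⟨K₁, hK₁⟩ := hL₁ (hb₁L hL)
    obtain ⟨K₂, hK₂⟩ := hL₂ (hb₂L hL)
    obtain ⟨B₁, hB₁⟩ := hf₁.exists_abs_le hK₁
    obtain ⟨B₂, hB₂⟩ := hf₂.exists_abs_le hK₂
    have huL := (hK₁.comp P₁.lipschitz).mul_of_abs_le (hK₂.comp P₂.lipschitz)
      (fun x => hB₁ (P₁ x)) (fun x => hB₂ (P₂ x))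
    have huB : ∀ x, |u x| ≤ (B₁ * B₂ : NNReal) := by
      intro x
      rw [abs_mul, NNReal.coe_mul]
      exact mul_le_mul (hB₁ _) (hB₂ _) (abs_nonneg _) B₁.coe_nonneg
    exact ⟨_, huL.mul_of_abs_le huL huB huB⟩

end Bump

theorem corollary4p2 {X : Type*} [NormedAddCommGroup X] [NormedSpace ℝ X] [CompleteSpace X]
    (X₁ X₂ : Submodule ℝ X) (hX₁ : IsClosed (X₁ : Set X)) (hX₂ : IsClosed (X₂ : Set X))
    (hX : IsCompl X₁ X₂) (hdim₁ : ¬ FiniteDimensional ℝ X₁) (hdim₂ : ¬ FiniteDimensional ℝ X₂)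
    (p : ℕ∞) (hp : 1 ≤ p) :
    ((∃ b : X → ℝ, IsSmoothBump p b) ↔
      ∃ f : X → ℝ, IsSmoothBump p f ∧
        derivCone f ∩ (dualSummand X₁ X₂ ∪ dualSummand X₂ X₁) = {0} ∧
        derivOffZero f ∩ (dualSummand X₁ X₂ ∪ dualSummand X₂ X₁) = ∅) ∧
    ((∃ b : X → ℝ, IsSmoothLipschitzBump p b) ↔
      ∃ f : X → ℝ, IsSmoothLipschitzBump p f ∧
        derivCone f ∩ (dualSummand X₁ X₂ ∪ dualSummand X₂ X₁) = {0} ∧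
        derivOffZero f ∩ (dualSummand X₁ X₂ ∪ dualSummand X₂ X₁) = ∅) := by
  refine ⟨⟨?_, fun ⟨f, hf, _⟩ => ⟨f, hf⟩⟩, ⟨?_, fun ⟨f, hf, _⟩ => ⟨f, hf⟩⟩⟩
  · rintro ⟨b, hb⟩
    obtain ⟨f, h1, h2, h3, -⟩ :=
      hb.exists_derivative_avoids_dualSummands hX₁ hX₂ hX hdim₁ hdim₂ hp
    exact ⟨f, h1, h2, h3⟩
  · rintro ⟨b, hb, hL⟩
    obtain ⟨f, h1, h2, h3, h4⟩ :=
      hb.exists_derivative_avoids_dualSummands hX₁ hX₂ hX hdim₁ hdim₂ hp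
    exact ⟨f, ⟨h1, h4 hL⟩, h2, h3⟩
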